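/- For $x\in(0,1]$ let $T(x)=\lfloor 1/x\rfloor\left(\lfloor 1/x+1\rfloor x-1\right)\in(0,1]$ be the Lüroth map, let $d_n(x)=\lfloor 1/T^{n-1}(x)\rfloor+1$ $(n\ge 1)$ be the Lüroth digits of $x$, and put $$Q_n(x)=d_n(x)\prod_{j=1}^{n-1}d_j(x)\,(d_j(x)-1),\qquad P_n(x)=Q_n(x)\sum_{k=1}^{n}\frac{1}{d_k(x)\prod_{j=1}^{k-1}d_j(x)\,(d_j(x)-1)},$$ so that $P_n(x)/Q_n(x)$ is the $n$-th Lüroth convergent of $x$. For $\tau\ge 0$ let $L(\tau)$, the set of Lüroth $\tau$-well approximable numbers, be the set of all $x\in(0,1]$ such that $$\left|x-\frac{P_n(x)}{Q_n(x)}\right|<\frac{1}{Q_n(x)^{1+\tau}}\quad\text{for infinitely many } n\ge 1.$$ Then for every $\tau\ge 0$ the Hausdorff dimension of $L(\tau)$ is $$\dim L(\tau)=\frac{1}{1+\tau},$$ and for every $\tau>0$ its Hausdorff measure at the critical exponent is infinite: $\mathcal H^{1/(1+\tau)}(L(\tau))=+\infty$. -/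

import Mathlib

noncomputable section

namespace Luroth

/-- The Lüroth map `T`; only its values on `(0, 1]` matter, and it maps `(0, 1]` to itself. -/
def map (x : ℝ) : ℝ := (⌊1 / x⌋₊ : ℝ) * ((⌊1 / x + 1⌋₊ : ℝ) * x - 1)

/-- The `n`-th Lüroth digit `d_n(x) = ⌊1 / T^{n-1}(x)⌋ + 1` of `x ∈ (0, 1]`, for `n ≥ 1`
(the index `n = 0` has no meaning and plays no role). -/
def digit (x : ℝ) (n : ℕ) : ℕ := ⌊1 / map^[n - 1] x⌋₊ + 1

/-- The unsimplified denominator `Q_n(x) = d_n ∏_{1 ≤ j < n} d_j (d_j - 1)`, for `n ≥ 1`. -/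
def Q (x : ℝ) (n : ℕ) : ℝ :=
  (digit x n : ℝ) * ∏ j ∈ Finset.Ico 1 n, (digit x j : ℝ) * ((digit x j : ℝ) - 1)

/-- The `n`-th Lüroth convergent of `x`: the `n`-th partial sum
`∑_{1 ≤ k ≤ n} 1 / (d_k ∏_{1 ≤ j < k} d_j (d_j - 1))` of the Lüroth expansion. -/
def convergent (x : ℝ) (n : ℕ) : ℝ :=
  ∑ k ∈ Finset.Icc 1 n,
    1 / ((digit x k : ℝ) * ∏ j ∈ Finset.Ico 1 k, (digit x j : ℝ) * ((digit x j : ℝ) - 1))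

/-- The unsimplified numerator `P_n(x) = [d_1, …, d_n] Q_n(x)`, for `n ≥ 1`. -/
def P (x : ℝ) (n : ℕ) : ℝ := convergent x n * Q x n

/-- The set `L(τ)` of Lüroth `τ`-well approximable numbers: the `x ∈ (0, 1]` for which
`|x - P_n(x) / Q_n(x)| < 1 / Q_n(x)^{1 + τ}` holds for infinitely many `n`. -/
def wellApproximable (τ : ℝ) : Set ℝ :=
  Filter.limsup
    (fun n : ℕ => {x : ℝ | x ∈ Set.Ioc (0 : ℝ) 1 ∧ |x - P x n / Q x n| < 1 / Q x n ^ (1 + τ)})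
    Filter.atTop

end Luroth

end

/-! Split off the last digit: let `w` be the word of the first n - 1 digits of x, ℓ the length of
its cylinder, k + 2 the n-th digit and y = T^n x. Then Q_n = (k + 2) / ℓ, the n-th convergent is the
left endpoint of the order-n cylinder, and the approximation condition becomes ℓ y / ((k + 1)(k +
2)) < (ℓ / (k + 2)) ^ (1 + τ) (`expand_approx_iff`).

Upper bound: these conditions give covers of L(τ) by intervals of length (ℓ / (k + 2)) ^ (1 + τ).
For s > 1 / (1 + τ) the s-th powers are summable, with sums that decay geometrically in the starting
order.

Lower bound, for τ > 0 and s = 1 / (1 + τ): digit 2 followed by a remainder y comparable to ℓ ^ τ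
gives, in every cylinder, an interval of admissible points whose length to the power s is a constant
times ℓ (`isLayer_cylinder`). Infinite measure then follows without constructing a measure on L(τ)
(`hausdorffMeasure_limsup_eq_top`). Were the measure finite, L(τ) would have a cover by open
intervals of total length below 1/2 with summable s-th powers. Call an interval good if the covering
intervals that meet it have total length less than half of its own. Good intervals contain good
distinguished intervals of arbitrarily fine layers (`exists_hitLength_lt`). Nesting them yields a
point of L(τ) that no covering interval can contain. The case τ = 0 is a limit of τ > 0. -/

noncomputable section

open Set Filter MeasureTheory Topology
open scoped ENNReal

namespace Luroth

/-! ### Infinite Hausdorff measure of limsup sets -/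

/-- The total length of those intervals `(a i, b i)` that meet `[u, v]`. -/
def hitLength (a b : ℕ → ℝ) (u v : ℝ) : ℝ≥0∞ :=
  ∑' i, {i | (Ioo (a i) (b i) ∩ Icc u v).Nonempty}.indicator
    (fun i => ENNReal.ofReal (b i - a i)) i

lemma tsum_indicator_mem_le_one {ι : Type*} {A : ι → Set ℝ}
    (hA : Pairwise (Function.onFun Disjoint A)) (x : ℝ) :
    ∑' w, (A w).indicator (fun _ => (1 : ℝ≥0∞)) x ≤ 1 := by
  by_cases h : ∃ w, x ∈ A w
  · obtain ⟨w, hw⟩ := h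
    rw [tsum_eq_single w]
    · simp [hw]
    · intro w' hne
      have := Set.disjoint_left.1 (hA hne)
      exact indicator_of_notMem (fun h' => this h' hw) _
  · push Not at h
    simp [h]

/-- If intervals meeting `[u, v]` have total length at least `(v - u) / 2`, the sum of the `s`-th
powers of their lengths is at least `(v - u) ^ s / 2`. -/
lemma half_rpow_le_of_half_le {s : ℝ} (hs0 : 0 < s) (hs1 : s < 1) {S : Set ℕ} {l : ℕ → ℝ}
    (hl : ∀ i, 0 < l i) {L : ℝ} (hL : 0 < L)
    (h : ENNReal.ofReal (L / 2) ≤ ∑' i, S.indicator (fun i => ENNReal.ofReal (l i)) i) :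
    ENNReal.ofReal (L ^ s / 2) ≤ ∑' i, S.indicator (fun i => ENNReal.ofReal (l i ^ s)) i := by
  -- One interval of length at least `L` suffices alone. If all are shorter, s < 1 gives l ^ s ≥ L ^
  -- (s - 1) * l for each, and these sum to at least L ^ (s - 1) * L / 2.
  by_cases hbig : ∃ i ∈ S, L ≤ l i
  · obtain ⟨i, hi, hLi⟩ := hbig
    refine le_trans ?_ (ENNReal.le_tsum i)
    rw [indicator_of_mem hi]
    apply ENNReal.ofReal_le_ofReal
    have h1 : L ^ s ≤ l i ^ s := Real.rpow_le_rpow hL.le hLi hs0.le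
    have h2 : 0 < L ^ s := Real.rpow_pos_of_pos hL s
    linarith
  · push Not at hbig
    have key : ∀ i, ENNReal.ofReal (L ^ (s - 1)) * S.indicator (fun i => ENNReal.ofReal (l i)) i
        ≤ S.indicator (fun i => ENNReal.ofReal (l i ^ s)) i := by
      intro i
      by_cases hi : i ∈ S
      · rw [indicator_of_mem hi, indicator_of_mem hi,
          ← ENNReal.ofReal_mul (Real.rpow_nonneg hL.le _)]
        apply ENNReal.ofReal_le_ofReal
        have h1 : L ^ (s - 1) ≤ l i ^ (s - 1) :=
          Real.rpow_le_rpow_of_nonpos (hl i) (hbig i hi).le (by linarith)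
        calc L ^ (s - 1) * l i ≤ l i ^ (s - 1) * l i := by
              gcongr
              exact (hl i).le
          _ = l i ^ s := by
              rw [Real.rpow_sub_one (hl i).ne', div_mul_cancel₀ _ (hl i).ne']
      · simp [indicator_of_notMem hi]
    calc ENNReal.ofReal (L ^ s / 2)
        = ENNReal.ofReal (L ^ (s - 1)) * ENNReal.ofReal (L / 2) := by
          rw [← ENNReal.ofReal_mul (Real.rpow_nonneg hL.le _), Real.rpow_sub_one hL.ne']
          congr 1
          field_simp
      _ ≤ ENNReal.ofReal (L ^ (s - 1)) * ∑' i, S.indicator (fun i => ENNReal.ofReal (l i)) i := by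
          gcongr
      _ = ∑' i, ENNReal.ofReal (L ^ (s - 1)) * S.indicator (fun i => ENNReal.ofReal (l i)) i :=
          ENNReal.tsum_mul_left.symm
      _ ≤ _ := ENNReal.tsum_le_tsum key

/-- A partition of `(0, 1]` into intervals `(α w, β w]`, each with a closed subinterval
`[γ w, δ w]` whose length raised to the power `s` is at least `κ` times the length of
`(α w, β w]`. -/
structure IsLayer {ι : Type*} (s κ ε : ℝ) (α β γ δ : ι → ℝ) : Prop where
  disjoint : Pairwise (Function.onFun Disjoint fun w => Ioc (α w) (β w))
  cover : Ioc (0 : ℝ) 1 ⊆ ⋃ w, Ioc (α w) (β w)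
  mesh : ∀ w, β w - α w ≤ ε
  left_lt : ∀ w, α w < γ w
  lt : ∀ w, γ w < δ w
  le_right : ∀ w, δ w ≤ β w
  le_rpow : ∀ w, κ * (β w - α w) ≤ (δ w - γ w) ^ s

/-- The intervals of a layer that meet `(a, b)` without being contained in it are at most two. -/
lemma tsum_indicator_meets_le_two {ι : Type*} {α β : ι → ℝ}
    (hdisj : Pairwise (Function.onFun Disjoint fun w => Ioc (α w) (β w))) (a b : ℝ) :
    ∑' w, {w | (Ioo a b ∩ Ioc (α w) (β w)).Nonempty ∧ ¬ Ioc (α w) (β w) ⊆ Ioo a b}.indicator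
      (fun _ => (1 : ℝ≥0∞)) w ≤ 2 := by
  calc _ ≤ ∑' w, ((Ioc (α w) (β w)).indicator (fun _ => (1 : ℝ≥0∞)) a +
        (Ioc (α w) (β w)).indicator (fun _ => (1 : ℝ≥0∞)) b) := by
        apply ENNReal.tsum_le_tsum
        intro w
        apply indicator_apply_le
        rintro ⟨⟨x, ⟨h1, h2⟩, h3, h4⟩, hn⟩
        by_cases ha : α w < a
        · rw [indicator_of_mem (show a ∈ Ioc (α w) (β w) from ⟨ha, by linarith⟩)]
          exact le_self_add
        · by_cases hb : b ≤ β w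
          · rw [indicator_of_mem (show b ∈ Ioc (α w) (β w) from ⟨by linarith, hb⟩)]
            exact le_add_self
          · exact absurd (fun y hy => ⟨by linarith [hy.1], by linarith [hy.2]⟩) hn
    _ = _ := ENNReal.tsum_add
    _ ≤ 1 + 1 := add_le_add (tsum_indicator_mem_le_one hdisj a) (tsum_indicator_mem_le_one hdisj b)
    _ = 2 := by norm_num

/-- The main step of the construction: an interval in which a given family of open intervals with
`∑ (b i - a i) ^ s < ∞` occupies less than half of the length contains, for every sufficiently fine
layer, a distinguished interval with the same property. -/
lemma exists_hitLength_lt {s κ : ℝ} (hs0 : 0 < s) (hs1 : s < 1) (hκ : 0 < κ) {a b : ℕ → ℝ}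
    (hab : ∀ i, a i < b i) (hsum : ∑' i, ENNReal.ofReal (b i - a i) ≠ ⊤)
    (hsums : ∑' i, ENNReal.ofReal ((b i - a i) ^ s) ≠ ⊤) {u v : ℝ} (huv : u < v)
    (hu : 0 ≤ u) (hv : v ≤ 1) (hgood : hitLength a b u v < ENNReal.ofReal ((v - u) / 2)) :
    ∃ ε₀ > 0, ∀ {ι : Type} [Countable ι] {α β γ δ : ι → ℝ}, IsLayer s κ ε₀ α β γ δ →
      ∃ w, Icc (γ w) (δ w) ⊆ Icc u v ∧
        hitLength a b (γ w) (δ w) < ENNReal.ofReal ((δ w - γ w) / 2) := by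
  set g : ℝ := (v - u) / 2 with hg
  have hg0 : 0 < g := by rw [hg]; linarith
  have t1 := ENNReal.tendsto_tsum_compl_atTop_zero hsum
  have t2 := ENNReal.tendsto_tsum_compl_atTop_zero hsums
  -- The finitely many intervals in `F` are handled by a fine mesh, the rest by small tails. The
  -- constants g / 4 and κ g / 16 are what the two final counts require.
  have e1 : ∀ᶠ F : Finset ℕ in atTop, ∑' i : {i // i ∉ F}, ENNReal.ofReal (b i - a i)
      < ENNReal.ofReal (g / 4) := t1.eventually_lt_const (by simpa using by linarith)
  have e2 : ∀ᶠ F : Finset ℕ in atTop, ∑' i : {i // i ∉ F}, ENNReal.ofReal ((b i - a i) ^ s)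
      < ENNReal.ofReal (κ * g / 16) := t2.eventually_lt_const (by simpa using by positivity)
  obtain ⟨F, hF1, hF2⟩ := (e1.and e2).exists
  set ε : ℝ := g / (8 * (F.card + 1)) with hε
  have hε0 : 0 < ε := by positivity
  refine ⟨ε, hε0, ?_⟩
  intro ι _ α β γ δ hlay
  by_contra hcon
  push Not at hcon
  set H : Set ℕ := {i | (Ioo (a i) (b i) ∩ Icc u v).Nonempty} with hH
  -- Cells on which badness must be paid for by the tail alone: no interval of `F` meets the
  -- distinguished interval, and no covering interval swallows the cell, so that each one is charged
  -- by at most two cells.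
  set W : Set ι := {w | Ioc (α w) (β w) ⊆ Ioc u v ∧
    (∀ i ∈ F, ¬ (Ioo (a i) (b i) ∩ Icc (γ w) (δ w)).Nonempty) ∧
    ∀ i, ¬ Ioc (α w) (β w) ⊆ Ioo (a i) (b i)} with hW
  have hJ : ∀ w, Icc (γ w) (δ w) ⊆ Ioc (α w) (β w) := fun w x hx =>
    ⟨(hlay.left_lt w).trans_le hx.1, hx.2.trans (hlay.le_right w)⟩
  classical
  -- A cell outside `W` either sticks out of (u, v], or lies within the mesh of an interval of `F`
  -- that meets [u, v], or is swallowed by an interval, which then cannot belong to `F`.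
  have hcover : Ioc u v ⊆ ((Ioc u (u + ε) ∪ Icc (v - ε) v) ∪
      (⋃ i ∈ F.filter (· ∈ H), Icc (a i - ε) (b i + ε))) ∪
      ((⋃ i : {i // i ∉ F}, Ioo (a i) (b i)) ∪ ⋃ w : W, Ioc (α w) (β w)) := by
    intro x hx
    obtain ⟨w, hw⟩ := mem_iUnion.1 (hlay.cover ⟨hu.trans_lt hx.1, hx.2.trans hv⟩)
    have hm := hlay.mesh w
    by_cases h1 : Ioc (α w) (β w) ⊆ Ioc u v
    · by_cases h2 : ∃ i ∈ F, (Ioo (a i) (b i) ∩ Icc (γ w) (δ w)).Nonempty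
      · obtain ⟨i, hi, y, hy1, hy2⟩ := h2
        refine Or.inl (Or.inr ?_)
        have hy3 := hJ w hy2
        refine mem_biUnion (x := i) ?_ ?_
        · simp only [Finset.coe_filter, mem_ofPred_eq]
          exact ⟨hi, y, hy1, Ioc_subset_Icc_self (h1 hy3)⟩
        · exact ⟨by linarith [hy1.1, hy3.2, hw.1], by linarith [hy1.2, hy3.1, hw.2]⟩
      · by_cases h3 : ∃ i, Ioc (α w) (β w) ⊆ Ioo (a i) (b i)
        · obtain ⟨i, hi⟩ := h3
          refine Or.inr (Or.inl (mem_iUnion.2 ⟨⟨i, fun hiF => h2 ⟨i, hiF, γ w, ?_⟩⟩, hi hw⟩))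
          have : γ w ∈ Icc (γ w) (δ w) := ⟨le_rfl, (hlay.lt w).le⟩
          exact ⟨hi (hJ w this), this⟩
        · push Not at h2 h3
          refine Or.inr (Or.inr (mem_iUnion.2 ⟨⟨w, h1, fun i hi => ?_, h3⟩, hw⟩))
          rw [h2 i hi]
          exact not_nonempty_empty
    · refine Or.inl (Or.inl ?_)
      by_contra hx'
      simp only [mem_union, mem_Ioc, mem_Icc, not_or, not_and, not_le] at hx'
      refine h1 (Ioc_subset_Ioc ?_ ?_)
      · linarith [hx'.1 hx.1, hw.2]
      · by_contra hlt
        push Not at hlt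
        linarith [hx'.2 (by linarith [hw.1]), hx.2]
  have hHsum : ∑ i ∈ F.filter (· ∈ H), ENNReal.ofReal (b i - a i) ≤ ENNReal.ofReal g := by
    refine le_trans ?_ hgood.le
    refine le_trans ?_ (ENNReal.sum_le_tsum (F.filter (· ∈ H)))
    apply Finset.sum_le_sum
    intro i hi
    rw [indicator_of_mem (Finset.mem_filter.1 hi).2]
  -- Of the length 2g, the two ends and the enlargements take 2ε(|F| + 1) = g / 4, the intervals of
  -- `F` at most g by goodness, and the tail g / 4. At least g / 2 is left for `W`.
  have hWsum : ENNReal.ofReal (g / 2) ≤ ∑' w : W, ENNReal.ofReal (β w - α w) := by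
    have hvol := measure_mono (μ := volume) hcover
    rw [Real.volume_Ioc] at hvol
    have hle : ENNReal.ofReal (v - u) ≤ ENNReal.ofReal (3 / 2 * g) +
        ∑' w : W, ENNReal.ofReal (β w - α w) := by
      refine hvol.trans ?_
      refine (measure_union_le _ _).trans ?_
      have m1 : volume (Ioc u (u + ε) ∪ Icc (v - ε) v) ≤ ENNReal.ofReal (2 * ε) := by
        refine (measure_union_le _ _).trans ?_
        rw [Real.volume_Ioc, Real.volume_Icc, ← ENNReal.ofReal_add (by linarith) (by linarith)]
        apply ENNReal.ofReal_le_ofReal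
        linarith
      have m2 : volume (⋃ i ∈ F.filter (· ∈ H), Icc (a i - ε) (b i + ε)) ≤
          ENNReal.ofReal g + ENNReal.ofReal (2 * ε * F.card) := by
        refine (measure_biUnion_finset_le _ _).trans ?_
        have : ∀ i ∈ F.filter (· ∈ H), volume (Icc (a i - ε) (b i + ε)) =
            ENNReal.ofReal (b i - a i) + ENNReal.ofReal (2 * ε) := by
          intro i _
          rw [Real.volume_Icc, ← ENNReal.ofReal_add (by linarith [hab i]) (by linarith)]
          congr 1
          ring
        rw [Finset.sum_congr rfl this, Finset.sum_add_distrib]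
        refine add_le_add hHsum ?_
        rw [Finset.sum_const, nsmul_eq_mul, mul_comm (2 * ε), ENNReal.ofReal_mul (p := (F.card : ℝ)) (by positivity),
          ENNReal.ofReal_natCast]
        gcongr
        exact Finset.filter_subset _ _
      have m3 : volume (⋃ i : {i // i ∉ F}, Ioo (a i) (b i)) ≤ ENNReal.ofReal (g / 4) := by
        refine (measure_iUnion_le _).trans ?_
        simpa only [Real.volume_Ioo] using hF1.le
      have m4 : volume (⋃ w : W, Ioc (α w) (β w)) ≤ ∑' w : W, ENNReal.ofReal (β w - α w) := by
        refine (measure_iUnion_le _).trans ?_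
        simp only [Real.volume_Ioc, le_refl]
      refine (add_le_add ((measure_union_le _ _).trans (add_le_add m1 m2))
        ((measure_union_le _ _).trans (add_le_add m3 m4))).trans ?_
      rw [← add_assoc]
      gcongr
      rw [← ENNReal.ofReal_add (by positivity) (by positivity),
        ← ENNReal.ofReal_add (by positivity) (by positivity),
        ← ENNReal.ofReal_add (by positivity) (by positivity)]
      apply ENNReal.ofReal_le_ofReal
      have : ε * (8 * (F.card + 1)) = g := by rw [hε]; field_simp
      nlinarith
    have h2 : ENNReal.ofReal (v - u) = ENNReal.ofReal (3 / 2 * g) + ENNReal.ofReal (g / 2) := by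
      rw [← ENNReal.ofReal_add (by positivity) (by positivity)]
      congr 1
      rw [hg]; ring
    rw [h2] at hle
    exact (ENNReal.add_le_add_iff_left ENNReal.ofReal_ne_top).1 hle
  have hbad : ∀ w : W, ENNReal.ofReal (κ / 2) * ENNReal.ofReal (β w - α w) ≤
      ∑' i : {i // i ∉ F}, ENNReal.ofReal ((b i - a i) ^ s) *
        {w | (Ioo (a i) (b i) ∩ Ioc (α w) (β w)).Nonempty ∧
          ¬ Ioc (α w) (β w) ⊆ Ioo (a i) (b i)}.indicator (fun _ => (1 : ℝ≥0∞)) w := by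
    rintro ⟨w, hw1, hw2, hw3⟩
    have hsubs : Icc (γ w) (δ w) ⊆ Icc u v := fun x hx => Ioc_subset_Icc_self (hw1 (hJ w hx))
    have hb := half_rpow_le_of_half_le hs0 hs1 (fun i => sub_pos.2 (hab i))
      (sub_pos.2 (hlay.lt w)) (hcon w hsubs)
    rw [← ENNReal.ofReal_mul (by positivity)]
    refine le_trans (ENNReal.ofReal_le_ofReal ?_) (hb.trans ?_)
    · linarith [hlay.le_rpow w]
    · rw [← tsum_subtype_eq_of_support_subset (s := {i | i ∉ F})]
      · apply ENNReal.tsum_le_tsum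
        rintro ⟨i, hi⟩
        refine indicator_apply_le (g := fun i => ENNReal.ofReal ((b i - a i) ^ s) *
          {w | (Ioo (a i) (b i) ∩ Ioc (α w) (β w)).Nonempty ∧
            ¬ Ioc (α w) (β w) ⊆ Ioo (a i) (b i)}.indicator (fun _ => (1 : ℝ≥0∞)) w) fun hne => ?_
        rw [indicator_of_mem, mul_one]
        exact ⟨hne.mono (inter_subset_inter_right _ (hJ w)), hw3 i⟩
      · intro i hi hiF
        have hne : i ∈ {i | (Ioo (a i) (b i) ∩ Icc (γ w) (δ w)).Nonempty} :=
          mem_of_indicator_ne_zero (Function.mem_support.1 hi)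
        exact hw2 i hiF hne
  -- Summing over cells and exchanging the sums charges each tail interval at most twice, so κ g / 4
  -- ≤ κ g / 8, which is absurd.
  have hfin : ENNReal.ofReal (κ / 2) * ENNReal.ofReal (g / 2) ≤
      2 * ENNReal.ofReal (κ * g / 16) := by
    calc _ ≤ ENNReal.ofReal (κ / 2) * ∑' w : W, ENNReal.ofReal (β w - α w) := by gcongr
      _ = ∑' w : W, ENNReal.ofReal (κ / 2) * ENNReal.ofReal (β w - α w) :=
        ENNReal.tsum_mul_left.symm
      _ ≤ _ := ENNReal.tsum_le_tsum hbad
      _ = _ := ENNReal.tsum_comm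
      _ ≤ ∑' i : {i // i ∉ F}, ENNReal.ofReal ((b i - a i) ^ s) * 2 := by
        apply ENNReal.tsum_le_tsum
        intro i
        rw [ENNReal.tsum_mul_left]
        gcongr
        refine le_trans ?_ (tsum_indicator_meets_le_two hlay.disjoint (a i) (b i))
        exact ENNReal.tsum_comp_le_tsum_of_injective Subtype.val_injective _
      _ = 2 * ∑' i : {i // i ∉ F}, ENNReal.ofReal ((b i - a i) ^ s) := by
        rw [ENNReal.tsum_mul_right, mul_comm]
      _ ≤ _ := by gcongr
  rw [← ENNReal.ofReal_mul (by positivity), ← ENNReal.ofReal_ofNat 2,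
    ← ENNReal.ofReal_mul (by positivity), ENNReal.ofReal_le_ofReal_iff (by positivity)] at hfin
  have : 0 < κ * g := by positivity
  linarith

/-- Sets of finite `s`-dimensional Hausdorff measure are covered by open intervals of small total
length whose lengths have a finite sum of `s`-th powers. -/
lemma exists_Ioo_cover {s : ℝ} (hs0 : 0 < s) (hs1 : s < 1) {A : Set ℝ}
    (hA : μH[s] A ≠ ⊤) :
    ∃ a b : ℕ → ℝ, (∀ i, a i < b i) ∧ A ⊆ (⋃ i, Ioo (a i) (b i)) ∧
      ∑' i, ENNReal.ofReal (b i - a i) < ENNReal.ofReal (1 / 2) ∧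
      ∑' i, ENNReal.ofReal ((b i - a i) ^ s) ≠ ⊤ := by
  set M : ℝ := (μH[s] A).toReal + 1 with hM
  have hM0 : 0 < M := by positivity
  have hAM : μH[s] A < ENNReal.ofReal M := by
    rw [hM, ENNReal.lt_ofReal_iff_toReal_lt hA]
    linarith
  -- Sets of diameter D ≤ η satisfy D ≤ η ^ (1 - s) * D ^ s, so their diameters sum to at most η ^
  -- (1 - s) * M. Doubling the diameters and adding margins η / 2 ^ n on both sides gives the total
  -- required here to be below 1/2.
  obtain ⟨η, hη0, hη1⟩ : ∃ η : ℝ, 0 < η ∧ 2 * (η ^ (1 - s) * M) + 4 * η < 1 / 2 := by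
    have hc : Tendsto (fun η : ℝ => 2 * (η ^ (1 - s) * M) + 4 * η) (𝓝[>] 0) (𝓝 0) := by
      have h1 : Tendsto (fun η : ℝ => η ^ (1 - s)) (𝓝[>] 0) (𝓝 0) := by
        have := (Real.continuousAt_rpow_const 0 (1 - s) (Or.inr (by linarith))).tendsto
        rw [Real.zero_rpow (by linarith)] at this
        exact this.mono_left nhdsWithin_le_nhds
      have h2 : Tendsto (fun η : ℝ => η) (𝓝[>] 0) (𝓝 0) :=
        tendsto_id.mono_left nhdsWithin_le_nhds
      simpa using ((h1.mul_const M).const_mul 2).add (h2.const_mul 4)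
    obtain ⟨η, h1, h2⟩ := ((hc.eventually_lt_const (show (0 : ℝ) < 1 / 2 by norm_num)).and
      self_mem_nhdsWithin).exists
    exact ⟨η, h2, h1⟩
  rw [Measure.hausdorffMeasure_apply] at hAM
  have hAη := (le_iSup₂ (f := fun (r : ℝ≥0∞) (_ : 0 < r) =>
    ⨅ (t : ℕ → Set ℝ) (_ : A ⊆ ⋃ n, t n) (_ : ∀ n, Metric.ediam (t n) ≤ r),
          ∑' n, ⨆ _ : (t n).Nonempty, Metric.ediam (t n) ^ s) (ENNReal.ofReal η)
          (by simpa using hη0)).trans_lt hAM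
  simp only [iInf_lt_iff] at hAη
  obtain ⟨t, hAt, htη, htM⟩ := hAη
  set D : ℕ → ℝ := fun n => (Metric.ediam (t n)).toReal with hD
  have hDt : ∀ n, Metric.ediam (t n) = ENNReal.ofReal (D n) := fun n =>
    (ENNReal.ofReal_toReal ((htη n).trans_lt ENNReal.ofReal_lt_top).ne).symm
  have hD0 : ∀ n, 0 ≤ D n := fun n => ENNReal.toReal_nonneg
  have hDη : ∀ n, D n ≤ η := fun n => by
    have := htη n
    rwa [hDt, ENNReal.ofReal_le_ofReal_iff hη0.le] at this
  have hDs : ∑' n, ENNReal.ofReal (D n ^ s) ≤ ENNReal.ofReal M := by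
    refine le_trans (ENNReal.tsum_le_tsum fun n => ?_) htM.le
    rw [← ENNReal.ofReal_rpow_of_nonneg (hD0 n) hs0.le, ← hDt]
    rcases (t n).eq_empty_or_nonempty with h | h
    · simp [h, hs0]
    · exact le_iSup (fun _ : (t n).Nonempty => Metric.ediam (t n) ^ s) h
  have hD1 : ∑' n, ENNReal.ofReal (D n) ≤ ENNReal.ofReal (η ^ (1 - s) * M) := by
    rw [ENNReal.ofReal_mul (by positivity)]
    refine le_trans ?_ (mul_le_mul_right hDs _)
    rw [← ENNReal.tsum_mul_left]
    refine ENNReal.tsum_le_tsum fun n => ?_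
    rw [← ENNReal.ofReal_mul (by positivity)]
    apply ENNReal.ofReal_le_ofReal
    calc D n = D n ^ ((1 - s) + s) := by simp
      _ = D n ^ (1 - s) * D n ^ s := Real.rpow_add_of_nonneg (hD0 n) (by linarith) hs0.le
      _ ≤ η ^ (1 - s) * D n ^ s := by
        gcongr
        exact hDη n
  have hcen : ∀ n, ∃ c : ℝ, t n ⊆ Icc (c - D n) (c + D n) := by
    intro n
    rcases (t n).eq_empty_or_nonempty with h | ⟨c, hc⟩
    · exact ⟨0, by simp [h]⟩
    · refine ⟨c, fun y hy => ?_⟩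
      have h1 := Metric.edist_le_ediam_of_mem hy hc
      rw [hDt, edist_dist, ENNReal.ofReal_le_ofReal_iff (hD0 n), Real.dist_eq, abs_le] at h1
      constructor <;> linarith [h1.1, h1.2]
  choose c hc using hcen
  have hgeo : ∀ q : ℝ, 0 ≤ q → q < 1 → ∀ K : ℝ, 0 ≤ K →
      ∑' n : ℕ, ENNReal.ofReal (K * q ^ n) = ENNReal.ofReal (K * (1 - q)⁻¹) := by
    intro q h0 h1 K hK
    rw [← ENNReal.ofReal_tsum_of_nonneg (fun n => by positivity)
      ((summable_geometric_of_lt_one h0 h1).mul_left K), tsum_mul_left,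
      tsum_geometric_of_lt_one h0 h1]
  refine ⟨fun n => c n - D n - η * (1 / 2) ^ n, fun n => c n + D n + η * (1 / 2) ^ n,
    fun n => ?_, ?_, ?_, ?_⟩
  · have : 0 < η * (1 / 2 : ℝ) ^ n := by positivity
    linarith [hD0 n]
  · refine hAt.trans (iUnion_mono fun n x hx => ?_)
    have : 0 < η * (1 / 2 : ℝ) ^ n := by positivity
    have hx' := hc n hx
    exact ⟨by linarith [hx'.1], by linarith [hx'.2]⟩
  · have e : ∀ n, ENNReal.ofReal (c n + D n + η * (1 / 2) ^ n - (c n - D n - η * (1 / 2) ^ n)) =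
        ENNReal.ofReal 2 * ENNReal.ofReal (D n) + ENNReal.ofReal (2 * η * (1 / 2) ^ n) := by
      intro n
      rw [← ENNReal.ofReal_mul (by norm_num), ← ENNReal.ofReal_add
        (by linarith [hD0 n]) (by positivity)]
      congr 1
      ring
    simp only [e]
    rw [ENNReal.tsum_add, ENNReal.tsum_mul_left,
      hgeo (1 / 2) (by norm_num) (by norm_num) _ (by positivity)]
    refine (add_le_add_left (mul_le_mul_right hD1 _) _).trans_lt ?_
    rw [← ENNReal.ofReal_mul (by norm_num), ← ENNReal.ofReal_add (by positivity) (by positivity)]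
    refine ENNReal.ofReal_lt_ofReal_iff (by norm_num) |>.2 ?_
    refine lt_of_eq_of_lt ?_ hη1
    norm_num
    ring
  -- Subadditivity of the s-th power separates the diameters from the margins, whose s-th powers
  -- form a geometric series.
  · refine ne_top_of_le_ne_top (b := ENNReal.ofReal ((2 : ℝ) ^ s) * ENNReal.ofReal M +
      ENNReal.ofReal ((2 * η) ^ s * (1 - (1 / 2) ^ s)⁻¹)) (by finiteness) ?_
    have hq1 : ((1 : ℝ) / 2) ^ s < 1 := Real.rpow_lt_one (by norm_num) (by norm_num) hs0
    rw [← hgeo ((1 / 2) ^ s) (by positivity) hq1 _ (by positivity)]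
    refine le_trans ?_ (add_le_add_left (mul_le_mul_right hDs _) _)
    rw [← ENNReal.tsum_mul_left, ← ENNReal.tsum_add]
    refine ENNReal.tsum_le_tsum fun n => ?_
    rw [← ENNReal.ofReal_mul (by positivity), ← ENNReal.ofReal_add
      (mul_nonneg (by positivity) (Real.rpow_nonneg (hD0 n) s)) (by positivity)]
    apply ENNReal.ofReal_le_ofReal
    have h1 : c n + D n + η * (1 / 2) ^ n - (c n - D n - η * (1 / 2) ^ n) =
      2 * D n + 2 * η * (1 / 2) ^ n := by ring
    rw [h1]
    refine (Real.rpow_add_le_add_rpow (by linarith [hD0 n]) (by positivity) hs0.le hs1.le).trans_eq ?_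
    rw [Real.mul_rpow (by norm_num) (hD0 n), Real.mul_rpow (by positivity) (by positivity),
      ← Real.rpow_natCast, ← Real.rpow_natCast, ← Real.rpow_mul (by norm_num),
      ← Real.rpow_mul (by norm_num), mul_comm (n : ℝ) s]

/-- A limsup set that contains, for every `m`, the distinguished intervals of some layer of mesh
at most `2 ^ (-m)` has infinite `s`-dimensional Hausdorff measure. -/
theorem hausdorffMeasure_limsup_eq_top {s κ : ℝ} (hs0 : 0 < s) (hs1 : s < 1) (hκ : 0 < κ)
    {E : ℕ → Set ℝ} {ι : ℕ → Type} [∀ m, Countable (ι m)] {α β γ δ : ∀ m, ι m → ℝ}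
    (hlay : ∀ m, IsLayer s κ ((1 / 2) ^ m) (α m) (β m) (γ m) (δ m))
    (hE : ∀ m w, Icc (γ m w) (δ m w) ⊆ ⋃ n ≥ m, E n) :
    μH[s] (limsup E atTop) = ⊤ := by
  by_contra hfin
  obtain ⟨a, b, hab, hcov, hsum, hsums⟩ := exists_Ioo_cover hs0 hs1 hfin
  let G := {p : ℝ × ℝ // p.1 < p.2 ∧ 0 ≤ p.1 ∧ p.2 ≤ 1 ∧
    hitLength a b p.1 p.2 < ENNReal.ofReal ((p.2 - p.1) / 2)}
  have step : ∀ (k : ℕ) (p : G), ∃ q : G, Icc q.1.1 q.1.2 ⊆ Icc p.1.1 p.1.2 ∧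
      Icc q.1.1 q.1.2 ⊆ (⋃ n ≥ k, E n) ∧ q.1.2 - q.1.1 ≤ (1 / 2) ^ k := by
    rintro k ⟨⟨u, v⟩, h1, h2, h3, h4⟩
    obtain ⟨ε₀, hε₀, H⟩ := exists_hitLength_lt hs0 hs1 hκ hab
      (hsum.trans ENNReal.ofReal_lt_top).ne hsums h1 h2 h3 h4
    obtain ⟨j, hj⟩ := exists_pow_lt_of_lt_one hε₀ (show (1 : ℝ) / 2 < 1 by norm_num)
    -- The layer must be fine enough for the selection and deep enough that its points lie in some
    -- `E n` with n ≥ k.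
    set m := max j k
    have hL := hlay m
    have hm : (1 / 2 : ℝ) ^ m ≤ ε₀ :=
      (pow_le_pow_of_le_one (by norm_num) (by norm_num) (le_max_left j k)).trans hj.le
    obtain ⟨w, hw1, hw2⟩ := H { hL with mesh := fun w => (hL.mesh w).trans hm }
    have hl := hw1 (left_mem_Icc.2 (hL.lt w).le)
    have hr := hw1 (right_mem_Icc.2 (hL.lt w).le)
    refine ⟨⟨(γ m w, δ m w), hL.lt w, h2.trans hl.1, hr.2.trans h3, hw2⟩, hw1, ?_, ?_⟩
    · refine (hE m w).trans ?_
      exact biUnion_subset_biUnion_left fun n hn => (le_max_right j k).trans hn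
    · have h5 : (1 / 2 : ℝ) ^ m ≤ (1 / 2) ^ k :=
        pow_le_pow_of_le_one (by norm_num) (by norm_num) (le_max_right j k)
      have h6 := hL.mesh w
      have h7 := hL.left_lt w
      have h8 := hL.le_right w
      show δ m w - γ m w ≤ _
      linarith
  have hstart : hitLength a b 0 1 < ENNReal.ofReal ((1 - 0) / 2) := by
    rw [sub_zero]
    refine lt_of_le_of_lt (ENNReal.tsum_le_tsum fun i => ?_) hsum
    exact indicator_le_self _ _ i
  choose next hn1 hn2 hn3 using step
  let I : ℕ → G := fun k => Nat.rec ⟨(0, 1), by norm_num, le_rfl, le_rfl, hstart⟩ next k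
  have hI : ∀ k, I (k + 1) = next k (I k) := fun k => rfl
  obtain ⟨x, hx⟩ : (⋂ k, Icc (I k).1.1 (I k).1.2).Nonempty := by
    apply IsCompact.nonempty_iInter_of_sequence_nonempty_isCompact_isClosed
    · intro k
      rw [hI]
      exact hn1 k (I k)
    · exact fun k => nonempty_Icc.2 (I k).2.1.le
    · exact isCompact_Icc
    · exact fun k => isClosed_Icc
  rw [mem_iInter] at hx
  have hxL : x ∈ limsup E atTop := by
    rw [mem_limsup_iff_frequently_mem, frequently_atTop]
    intro k
    have := hx (k + 1)
    rw [hI] at this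
    simpa using hn2 k (I k) this
  obtain ⟨i, hi⟩ := mem_iUnion.1 (hcov hxL)
  have hpos : 0 < min (x - a i) (b i - x) := lt_min (by linarith [hi.1]) (by linarith [hi.2])
  obtain ⟨k, hk⟩ := exists_pow_lt_of_lt_one hpos (show (1 : ℝ) / 2 < 1 by norm_num)
  have hxk := hx (k + 1)
  have hlen := hn3 k (I k)
  rw [← hI] at hlen
  obtain ⟨h1, -, -, h4⟩ := (I (k + 1)).2
  have ha := hk.trans_le (min_le_left _ _)
  have hb := hk.trans_le (min_le_right _ _)
  -- The covering interval around x meets the k-th good interval and is longer than it,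
  -- contradicting goodness.
  refine absurd h4 (not_lt.2 ?_)
  refine le_trans ?_ (ENNReal.le_tsum i)
  rw [indicator_of_mem (show i ∈ {i | (Ioo (a i) (b i) ∩ _).Nonempty} from ⟨x, hi, hxk⟩)]
  apply ENNReal.ofReal_le_ofReal
  linarith

/-! ### Inverse branches and cylinders of the Lüroth map -/

/-- The inverse branch of the Lüroth map on which the first digit is `k + 2`. -/
def branch (k : ℕ) (y : ℝ) : ℝ := 1 / (k + 2) + y / ((k + 1) * (k + 2))

lemma branch_mem {k : ℕ} {y : ℝ} (hy : y ∈ Ioc (0 : ℝ) 1) : branch k y ∈ Ioc (0 : ℝ) 1 := by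
  obtain ⟨h0, h1⟩ := hy
  refine ⟨by unfold branch; positivity, ?_⟩
  have hk : (0 : ℝ) ≤ k := Nat.cast_nonneg k
  have hb : branch k y = (k + 1 + y) / ((k + 1) * (k + 2)) := by
    unfold branch
    field_simp
  rw [hb, div_le_one (by positivity)]
  nlinarith

lemma floor_one_div_branch {k : ℕ} {y : ℝ} (hy : y ∈ Ioc (0 : ℝ) 1) :
    ⌊1 / branch k y⌋₊ = k + 1 := by
  obtain ⟨h0, h1⟩ := hy
  have hk : (0 : ℝ) ≤ k := Nat.cast_nonneg k
  have hb : branch k y = (k + 1 + y) / ((k + 1) * (k + 2)) := by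
    unfold branch
    field_simp
  rw [hb, one_div_div, Nat.floor_eq_iff (by positivity)]
  push_cast
  constructor
  · rw [le_div_iff₀ (by positivity)]
    nlinarith
  · rw [div_lt_iff₀ (by positivity)]
    nlinarith

lemma map_branch {k : ℕ} {y : ℝ} (hy : y ∈ Ioc (0 : ℝ) 1) : map (branch k y) = y := by
  have hpos := (branch_mem (k := k) hy).1
  unfold map
  rw [Nat.floor_add_one (by positivity), floor_one_div_branch hy]
  unfold branch
  push_cast
  field_simp
  ring

lemma exists_eq_branch {x : ℝ} (hx : x ∈ Ioc (0 : ℝ) 1) :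
    ∃ k : ℕ, ∃ y ∈ Ioc (0 : ℝ) 1, x = branch k y := by
  obtain ⟨h0, h1⟩ := hx
  have h1x : 1 ≤ 1 / x := by rwa [le_div_iff₀ h0, one_mul]
  obtain ⟨k, hk⟩ : ∃ k, ⌊1 / x⌋₊ = k + 1 :=
    ⟨⌊1 / x⌋₊ - 1, by have := Nat.floor_pos.2 h1x; omega⟩
  obtain ⟨ha, hb⟩ := (Nat.floor_eq_iff (by positivity)).1 hk
  push_cast at ha hb
  rw [le_div_iff₀ h0] at ha
  rw [div_lt_iff₀ h0] at hb
  have hk0 : (0 : ℝ) ≤ k := Nat.cast_nonneg k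
  refine ⟨k, (k + 1) * ((k + 2) * x - 1), ⟨?_, ?_⟩, ?_⟩
  · have : 0 < (k + 2) * x - 1 := by linarith
    positivity
  · nlinarith
  · unfold branch
    field_simp
    ring

/-- The composition of the inverse branches given by a word. -/
def expand : List ℕ → ℝ → ℝ
  | [], y => y
  | k :: w, y => branch k (expand w y)

/-- The length of the cylinder of a word. -/
def cylLength : List ℕ → ℝ
  | [] => 1
  | k :: w => cylLength w / ((k + 1) * (k + 2))

lemma cylLength_pos (w : List ℕ) : 0 < cylLength w := by
  induction w with
  | nil => simp [cylLength]
  | cons k w ih => unfold cylLength; positivity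

lemma cylLength_le (w : List ℕ) : cylLength w ≤ (1 / 2) ^ w.length := by
  induction w with
  | nil => simp [cylLength]
  | cons k w ih =>
    have hk : (0 : ℝ) ≤ k := Nat.cast_nonneg k
    have := cylLength_pos w
    unfold cylLength
    rw [List.length_cons, pow_succ, div_le_iff₀ (by positivity)]
    have h2 : 2 ≤ ((k : ℝ) + 1) * (k + 2) := by nlinarith
    have h3 : (0 : ℝ) < (1 / 2) ^ w.length := by positivity
    nlinarith

lemma expand_eq (w : List ℕ) (y : ℝ) : expand w y = expand w 0 + cylLength w * y := by
  induction w with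
  | nil => simp [expand, cylLength]
  | cons k w ih =>
    unfold expand cylLength
    rw [ih]
    unfold branch
    field_simp
    ring

lemma expand_mem {w : List ℕ} {y : ℝ} (hy : y ∈ Ioc (0 : ℝ) 1) : expand w y ∈ Ioc (0 : ℝ) 1 := by
  induction w with
  | nil => exact hy
  | cons k w ih => exact branch_mem ih

/-- The floor ⌊1/x⌋ recovers the first letter and T the rest. Equal lengths are essential, since
cylinders of different orders can be nested. -/
lemma expand_injective {w w' : List ℕ} (hl : w.length = w'.length) {y y' : ℝ}
    (hy : y ∈ Ioc (0 : ℝ) 1) (hy' : y' ∈ Ioc (0 : ℝ) 1) (h : expand w y = expand w' y') :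
    w = w' := by
  induction w generalizing w' with
  | nil => exact (List.length_eq_zero_iff.1 hl.symm).symm
  | cons k w ih =>
    cases w' with
    | nil => simp at hl
    | cons k' w' =>
      unfold expand at h
      have h1 := floor_one_div_branch (k := k) (expand_mem (w := w) hy)
      have h2 := map_branch (k := k) (expand_mem (w := w) hy)
      rw [h, floor_one_div_branch (expand_mem hy')] at h1
      rw [h, map_branch (expand_mem hy')] at h2
      rw [ih (by simpa using hl) h2.symm, Nat.succ_injective h1]

lemma exists_eq_expand (m : ℕ) {x : ℝ} (hx : x ∈ Ioc (0 : ℝ) 1) :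
    ∃ w : Fin m → ℕ, ∃ y ∈ Ioc (0 : ℝ) 1, x = expand (List.ofFn w) y := by
  induction m generalizing x with
  | zero => exact ⟨Fin.elim0, x, hx, by simp [expand]⟩
  | succ m ih =>
    obtain ⟨k, z, hz, rfl⟩ := exists_eq_branch hx
    obtain ⟨w, y, hy, rfl⟩ := ih hz
    exact ⟨Fin.cons k w, y, hy, by simp [List.ofFn_succ, expand]⟩

lemma mem_Ioc_expand_iff {w : List ℕ} {x : ℝ} :
    x ∈ Ioc (expand w 0) (expand w 1) ↔ ∃ y ∈ Ioc (0 : ℝ) 1, x = expand w y := by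
  have hpos := cylLength_pos w
  rw [expand_eq w 1]
  constructor
  · rintro ⟨h1, h2⟩
    refine ⟨(x - expand w 0) / cylLength w, ⟨by apply div_pos <;> linarith, ?_⟩, ?_⟩
    · rw [div_le_one hpos]; linarith
    · rw [expand_eq]; field_simp; ring
  · rintro ⟨y, ⟨h1, h2⟩, rfl⟩
    rw [expand_eq w y]
    constructor <;> nlinarith

/-! ### Denominators and convergents in terms of digit words -/

lemma digit_one (x : ℝ) : digit x 1 = ⌊1 / x⌋₊ + 1 := rfl

/-- The shift starts at index 2 because `digit` iterates T by the truncated n - 1; the recurrences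
below inherit this offset. -/
lemma digit_add_two (x : ℝ) (n : ℕ) : digit x (n + 2) = digit (map x) (n + 1) := rfl

lemma prod_Ico_digit (x : ℝ) (n : ℕ) :
    ∏ j ∈ Finset.Ico 1 (n + 2), (digit x j : ℝ) * ((digit x j : ℝ) - 1) =
      (digit x 1 : ℝ) * ((digit x 1 : ℝ) - 1) *
        ∏ j ∈ Finset.Ico 1 (n + 1), (digit (map x) j : ℝ) * ((digit (map x) j : ℝ) - 1) := by
  rw [Finset.prod_Ico_eq_prod_range, Finset.prod_Ico_eq_prod_range]
  simp only [Nat.add_sub_cancel, show n + 2 - 1 = n + 1 by omega]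
  rw [Finset.prod_range_succ', mul_comm]
  congr 1
  refine Finset.prod_congr rfl fun j _ => ?_
  rw [show 1 + (j + 1) = j + 2 by ring, digit_add_two, add_comm 1 j]

lemma Q_add_two (x : ℝ) (n : ℕ) :
    Q x (n + 2) = (digit x 1 : ℝ) * ((digit x 1 : ℝ) - 1) * Q (map x) (n + 1) := by
  unfold Q
  rw [prod_Ico_digit, digit_add_two]
  ring

lemma convergent_eq_sum_range (x : ℝ) (n : ℕ) :
    convergent x n = ∑ k ∈ Finset.range n, 1 / Q x (k + 1) := by
  unfold convergent Q
  rw [← Finset.Ico_add_one_right_eq_Icc, Finset.sum_Ico_eq_sum_range]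
  simp only [Nat.add_sub_cancel, add_comm 1]

lemma convergent_add_two (x : ℝ) (n : ℕ) :
    convergent x (n + 2) = 1 / (digit x 1 : ℝ) +
      convergent (map x) (n + 1) / ((digit x 1 : ℝ) * ((digit x 1 : ℝ) - 1)) := by
  rw [convergent_eq_sum_range, convergent_eq_sum_range, Finset.sum_range_succ', add_comm,
    Finset.sum_div]
  congr 1
  · simp [Q]
  · refine Finset.sum_congr rfl fun k _ => ?_
    rw [Q_add_two, div_div, mul_comm]

/-- The last digit enters Q_n as d_n and not as d_n (d_n - 1), so its branch is kept apart from `w`.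
The earlier factors multiply to the inverse of the cylinder length. -/
lemma Q_expand (w : List ℕ) (k : ℕ) {y : ℝ} (hy : y ∈ Ioc (0 : ℝ) 1) :
    Q (expand w (branch k y)) (w.length + 1) = (k + 2) / cylLength w := by
  induction w with
  | nil =>
    simp only [Q, expand, List.length_nil, zero_add, digit_one, floor_one_div_branch hy, cylLength]
    push_cast
    simp
    ring
  | cons j w ih =>
    have hz := expand_mem (w := w) (branch_mem (k := k) hy)
    rw [List.length_cons, Q_add_two]
    unfold expand
    rw [map_branch hz, ih, digit_one, floor_one_div_branch hz]
    rw [show cylLength (j :: w) = cylLength w / ((j + 1) * (j + 2)) from rfl]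
    have := cylLength_pos w
    push_cast
    field_simp
    ring

/-- Truncating the series amounts to replacing the remainder `y` by 0, which gives the left endpoint
of the cylinder. -/
lemma convergent_expand (w : List ℕ) (k : ℕ) {y : ℝ} (hy : y ∈ Ioc (0 : ℝ) 1) :
    convergent (expand w (branch k y)) (w.length + 1) = expand w (branch k 0) := by
  induction w with
  | nil =>
    rw [convergent_eq_sum_range]
    simp only [expand, List.length_nil, zero_add, Finset.sum_range_one, Q, digit_one,
      floor_one_div_branch hy]
    push_cast
    simp [branch]
    ring
  | cons j w ih =>
    have hz := expand_mem (w := w) (branch_mem (k := k) hy)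
    rw [List.length_cons, convergent_add_two]
    unfold expand
    rw [map_branch hz, ih, digit_one, floor_one_div_branch hz]
    rw [show ∀ z, branch j z = 1 / (j + 2) + z / ((j + 1) * (j + 2)) from fun z => rfl]
    push_cast
    ring

/-- The approximation condition in terms of the word of digits and the remainder. -/
lemma expand_approx_iff (τ : ℝ) (w : List ℕ) (k : ℕ) {y : ℝ} (hy : y ∈ Ioc (0 : ℝ) 1) :
    (|expand w (branch k y) - P (expand w (branch k y)) (w.length + 1) /
      Q (expand w (branch k y)) (w.length + 1)| <
        1 / Q (expand w (branch k y)) (w.length + 1) ^ (1 + τ)) ↔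
      cylLength w * (y / ((k + 1) * (k + 2))) < (cylLength w / (k + 2)) ^ (1 + τ) := by
  have hpos := cylLength_pos w
  have hQ : Q (expand w (branch k y)) (w.length + 1) ≠ 0 := by
    rw [Q_expand w k hy]; positivity
  have hy0 := hy.1
  unfold P
  rw [mul_div_cancel_right₀ _ hQ, Q_expand w k hy, convergent_expand w k hy,
    expand_eq w (branch k y), expand_eq w (branch k 0), one_div,
    ← Real.inv_rpow (by positivity), inv_div,
    show expand w 0 + cylLength w * branch k y - (expand w 0 + cylLength w * branch k 0) =
      cylLength w * (y / ((k + 1) * (k + 2))) by unfold branch; ring,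
    abs_of_pos (by positivity)]

lemma mem_wellApproximable {τ x : ℝ} : x ∈ wellApproximable τ ↔
    ∃ᶠ n in atTop, x ∈ Ioc (0 : ℝ) 1 ∧ |x - P x n / Q x n| < 1 / Q x n ^ (1 + τ) := by
  unfold wellApproximable
  rw [mem_limsup_iff_frequently_mem]
  rfl

/-! ### Infinite measure at the critical exponent -/

/-- The distinguished intervals `{x | d_{m+1}(x) = 2, T^{m+1} x ∈ [ρ / 2, ρ]}` with
`ρ = (ℓ / 2) ^ τ / 2`, where `ℓ` is the length of the cylinder of order `m`, form a layer. -/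
lemma isLayer_cylinder {τ : ℝ} (hτ : 0 < τ) (m : ℕ) :
    IsLayer (ι := Fin m → ℕ) (1 / (1 + τ)) (((1 / 2) ^ τ / 8) ^ (1 / (1 + τ))) ((1 / 2) ^ m)
      (fun w => expand (List.ofFn w) 0) (fun w => expand (List.ofFn w) 1)
      (fun w => expand (List.ofFn w) (branch 0 ((cylLength (List.ofFn w) / 2) ^ τ / 4)))
      (fun w => expand (List.ofFn w) (branch 0 ((cylLength (List.ofFn w) / 2) ^ τ / 2))) where
  disjoint w w' hne := by
    rw [Function.onFun, Set.disjoint_left]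
    intro x hx hx'
    obtain ⟨y, hy, rfl⟩ := mem_Ioc_expand_iff.1 hx
    obtain ⟨y', hy', h⟩ := mem_Ioc_expand_iff.1 hx'
    exact hne (List.ofFn_injective (expand_injective (by simp) hy hy' h))
  cover x hx := by
    obtain ⟨w, y, hy, h⟩ := exists_eq_expand m hx
    exact mem_iUnion.2 ⟨w, mem_Ioc_expand_iff.2 ⟨y, hy, h⟩⟩
  mesh w := by
    rw [expand_eq _ 1]
    have := cylLength_le (List.ofFn w)
    rw [List.length_ofFn] at this
    linarith
  left_lt w := by
    have h := cylLength_pos (List.ofFn w)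
    rw [expand_eq _ (branch _ _)]
    have : 0 < branch 0 ((cylLength (List.ofFn w) / 2) ^ τ / 4) := by unfold branch; positivity
    nlinarith
  lt w := by
    have h := cylLength_pos (List.ofFn w)
    have h' : 0 < (cylLength (List.ofFn w) / 2) ^ τ := by positivity
    rw [expand_eq _ (branch _ _), expand_eq _ (branch _ (_ / 2))]
    unfold branch
    gcongr
    norm_num
  le_right w := by
    have h := cylLength_pos (List.ofFn w)
    have h1 : cylLength (List.ofFn w) ≤ 1 :=
      (cylLength_le _).trans (pow_le_one₀ (by norm_num) (by norm_num))
    have h' : (cylLength (List.ofFn w) / 2) ^ τ ≤ 1 :=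
      Real.rpow_le_one (by positivity) (by linarith) hτ.le
    rw [expand_eq _ (branch _ _), expand_eq _ 1]
    have hy : (cylLength (List.ofFn w) / 2) ^ τ / 2 ∈ Ioc (0 : ℝ) 1 :=
      ⟨by positivity, by linarith⟩
    have := (branch_mem (k := 0) hy).2
    nlinarith
  le_rpow w := by
    have h := cylLength_pos (List.ofFn w)
    rw [expand_eq _ (branch _ (_ / 4)), expand_eq _ (branch _ _), expand_eq _ 1]
    set l := cylLength (List.ofFn w)
    -- The length is exactly a constant times l ^ (1 + τ), so its power 1 / (1 + τ) is exactly κ l.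
    -- This fixes κ.
    have e : expand (List.ofFn w) 0 + l * branch 0 ((l / 2) ^ τ / 2) -
        (expand (List.ofFn w) 0 + l * branch 0 ((l / 2) ^ τ / 4)) =
          ((1 / 2) ^ τ / 8) * l ^ (1 + τ) := by
      unfold branch
      rw [Real.rpow_add h, Real.rpow_one, div_eq_mul_one_div l 2,
        Real.mul_rpow h.le (by norm_num)]
      push_cast
      ring
    rw [e, Real.mul_rpow (by positivity) (by positivity), ← Real.rpow_mul h.le,
      mul_one_div_cancel (by positivity), Real.rpow_one]
    linarith

theorem hausdorffMeasure_wellApproximable {τ : ℝ} (hτ : 0 < τ) :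
    μH[1 / (1 + τ)] (wellApproximable τ) = ⊤ := by
  refine hausdorffMeasure_limsup_eq_top (by positivity)
    (by rw [div_lt_one (by positivity)]; linarith) (by positivity) (isLayer_cylinder hτ) ?_
  intro m w x hx
  set l := cylLength (List.ofFn w) with hl
  have hl0 : 0 < l := cylLength_pos _
  have hl1 : l ≤ 1 := (cylLength_le _).trans (pow_le_one₀ (by norm_num) (by norm_num))
  have hρ0 : 0 < (l / 2) ^ τ := by positivity
  have hρ1 : (l / 2) ^ τ ≤ 1 := Real.rpow_le_one (by positivity) (by linarith) hτ.le
  obtain ⟨y, hy1, hy2, rfl⟩ : ∃ y, (l / 2) ^ τ / 4 ≤ y ∧ y ≤ (l / 2) ^ τ / 2 ∧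
      x = expand (List.ofFn w) (branch 0 y) := by
    obtain ⟨h1, h2⟩ := hx
    rw [expand_eq _ (branch _ _)] at h1 h2
    -- Inverse of `expand` composed with the branch y ↦ 1/2 + y/2 of digit 2.
    refine ⟨2 * ((x - expand (List.ofFn w) 0) / l - 1 / 2), ?_, ?_, ?_⟩
    · have : branch 0 ((l / 2) ^ τ / 4) ≤ (x - expand (List.ofFn w) 0) / l := by
        rw [le_div_iff₀ hl0]
        linarith
      unfold branch at this
      norm_num at this
      linarith
    · have : (x - expand (List.ofFn w) 0) / l ≤ branch 0 ((l / 2) ^ τ / 2) := by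
        rw [div_le_iff₀ hl0]
        linarith
      unfold branch at this
      norm_num at this
      linarith
    · rw [expand_eq _ (branch _ _), ← hl]
      unfold branch
      push_cast
      field_simp
      ring
  have hy : y ∈ Ioc (0 : ℝ) 1 := ⟨by linarith, by linarith⟩
  -- The approximation has order m + 1: the m letters of `w` and the digit 2. With k = 0 the
  -- condition reduces to y < (l / 2) ^ τ.
  refine mem_iUnion₂.2 ⟨m + 1, by simp, expand_mem (branch_mem hy), ?_⟩
  have := (expand_approx_iff τ (List.ofFn w) 0 hy).2
  rw [List.length_ofFn] at this
  apply this
  rw [← hl]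
  push_cast
  rw [zero_add, Real.rpow_add (by positivity), Real.rpow_one]
  have : l / 2 * y < l / 2 * (l / 2) ^ τ := by
    gcongr
    linarith
  linarith

/-! ### Upper bound by covers at the convergents -/

lemma tsum_ofReal_branch_le_one :
    ∑' k : ℕ, ENNReal.ofReal (1 / (((k : ℝ) + 1) * (k + 2))) ≤ 1 := by
  refine ENNReal.tsum_le_of_sum_range_le fun n => ?_
  have h : ∑ k ∈ Finset.range n, (1 / (((k : ℝ) + 1) * (k + 2))) = 1 - 1 / ((n : ℝ) + 1) := by
    induction n with
    | zero => simp
    | succ n ih =>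
      rw [Finset.sum_range_succ, ih]
      push_cast
      field_simp
      ring
  rw [← ENNReal.ofReal_sum_of_nonneg fun k _ => by positivity, h, ENNReal.ofReal_le_one]
  have : 0 < 1 / ((n : ℝ) + 1) := by positivity
  linarith

/-- Every contraction ratio is at most 1/2, so raising it to the power t > 1 gains a factor (1/2) ^
(t - 1) over a sum that is at most 1. -/
lemma tsum_ofReal_branch_rpow_lt_one {t : ℝ} (ht : 1 < t) :
    ∑' k : ℕ, ENNReal.ofReal ((1 / (((k : ℝ) + 1) * (k + 2))) ^ t) < 1 := by
  have hle : ∀ k : ℕ, ENNReal.ofReal ((1 / (((k : ℝ) + 1) * (k + 2))) ^ t) ≤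
      ENNReal.ofReal ((1 / 2) ^ (t - 1)) * ENNReal.ofReal (1 / (((k : ℝ) + 1) * (k + 2))) := by
    intro k
    rw [← ENNReal.ofReal_mul (by positivity)]
    apply ENNReal.ofReal_le_ofReal
    have hk : (0 : ℝ) ≤ k := Nat.cast_nonneg k
    set x : ℝ := 1 / (((k : ℝ) + 1) * (k + 2)) with hx
    have hx0 : 0 < x := by positivity
    have hx2 : x ≤ 1 / 2 := by
      rw [hx]
      apply one_div_le_one_div_of_le (by norm_num)
      nlinarith
    calc x ^ t = x ^ (t - 1) * x := by rw [Real.rpow_sub_one hx0.ne', div_mul_cancel₀ _ hx0.ne']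
      _ ≤ _ := by gcongr
  refine (ENNReal.tsum_le_tsum hle).trans_lt ?_
  rw [ENNReal.tsum_mul_left]
  refine (mul_le_mul_right tsum_ofReal_branch_le_one _).trans_lt ?_
  rw [mul_one, ENNReal.ofReal_lt_one]
  exact Real.rpow_lt_one (by norm_num) (by norm_num) (by linarith)

/-- Cylinder lengths are products over the letters, so the sum over words factorises. -/
lemma tsum_cylLength_rpow (t : ℝ) (m : ℕ) :
    ∑' w : Fin m → ℕ, ENNReal.ofReal (cylLength (List.ofFn w) ^ t) =
      (∑' k : ℕ, ENNReal.ofReal ((1 / (((k : ℝ) + 1) * (k + 2))) ^ t)) ^ m := by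
  induction m with
  | zero => simp [cylLength]
  | succ m ih =>
    rw [← (Fin.consEquiv fun _ : Fin (m + 1) => ℕ).tsum_eq, ENNReal.tsum_prod', pow_succ', ← ih,
      ← ENNReal.tsum_mul_right]
    refine tsum_congr fun k => ?_
    rw [← ENNReal.tsum_mul_left]
    refine tsum_congr fun w => ?_
    have h := cylLength_pos (List.ofFn w)
    rw [← ENNReal.ofReal_mul (by positivity), ← Real.mul_rpow (by positivity) h.le]
    simp only [Fin.consEquiv_apply, List.ofFn_succ, Fin.cons_zero, Fin.cons_succ, cylLength]
    congr 2
    ring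

/-- The well approximable numbers are covered, for every `N`, by the intervals of length
`Q ^ (-(1 + τ))` to the right of the convergents of order greater than `N`. -/
lemma wellApproximable_subset (τ : ℝ) (N : ℕ) :
    wellApproximable τ ⊆ ⋃ i : Σ m : ℕ, (Fin (N + m) → ℕ) × ℕ,
      Icc (expand (List.ofFn i.2.1) (branch i.2.2 0))
        (expand (List.ofFn i.2.1) (branch i.2.2 0) +
          (cylLength (List.ofFn i.2.1) / (i.2.2 + 2)) ^ (1 + τ)) := by
  intro x hx
  obtain ⟨n, hn, hx01, h⟩ := (frequently_atTop.1 (mem_wellApproximable.1 hx)) (N + 1)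
  obtain ⟨m, rfl⟩ : ∃ m, n = (N + m) + 1 := ⟨n - (N + 1), by omega⟩
  obtain ⟨w, z, hz, rfl⟩ := exists_eq_expand (N + m) hx01
  obtain ⟨k, y, hy, rfl⟩ := exists_eq_branch hz
  have key := (expand_approx_iff τ (List.ofFn w) k hy).1 (by rwa [List.length_ofFn])
  refine mem_iUnion.2 ⟨⟨m, w, k⟩, ?_⟩
  have h0 := hy.1
  have hl := cylLength_pos (List.ofFn w)
  have e : expand (List.ofFn w) (branch k y) = expand (List.ofFn w) (branch k 0) +
      cylLength (List.ofFn w) * (y / ((k + 1) * (k + 2))) := by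
    rw [expand_eq _ (branch k y), expand_eq _ (branch k 0)]
    unfold branch
    ring
  rw [e]
  exact ⟨le_add_of_nonneg_right (by positivity), add_le_add_right key.le _⟩

lemma hausdorffMeasure_wellApproximable_eq_zero {τ : ℝ} (hτ : 0 ≤ τ) {s : ℝ}
    (hs : 1 / (1 + τ) < s) : μH[s] (wellApproximable τ) = 0 := by
  have hs0 : 0 < s := lt_trans (by positivity) hs
  set t : ℝ := (1 + τ) * s with ht
  have ht1 : 1 < t := by
    rw [div_lt_iff₀ (by positivity)] at hs
    linarith
  set p : ℝ≥0∞ := ∑' k : ℕ, ENNReal.ofReal ((1 / (((k : ℝ) + 1) * (k + 2))) ^ t) with hp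
  have hp1 : p < 1 := tsum_ofReal_branch_rpow_lt_one ht1
  set Z : ℝ≥0∞ := ∑' k : ℕ, ENNReal.ofReal ((1 / ((k : ℝ) + 2)) ^ t) with hZ
  have hZtop : Z ≠ ⊤ := by
    have hsum : Summable fun k : ℕ => (1 / ((k : ℝ) + 2)) ^ t := by
      have := (summable_nat_add_iff 2).2 (Real.summable_one_div_nat_rpow.2 ht1)
      refine this.congr fun k => ?_
      rw [Real.div_rpow (by norm_num) (by positivity), Real.one_rpow]
      push_cast
      rfl
    exact hsum.tsum_ofReal_ne_top
  have hdiam : ∀ (N : ℕ) (i : Σ m : ℕ, (Fin (N + m) → ℕ) × ℕ),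
      Metric.ediam (Icc (expand (List.ofFn i.2.1) (branch i.2.2 0))
        (expand (List.ofFn i.2.1) (branch i.2.2 0) +
          (cylLength (List.ofFn i.2.1) / (i.2.2 + 2)) ^ (1 + τ))) =
      ENNReal.ofReal ((cylLength (List.ofFn i.2.1) / (i.2.2 + 2)) ^ (1 + τ)) := by
    intro N i
    rw [Real.ediam_Icc, add_sub_cancel_left]
  have hr : Tendsto (fun N : ℕ => ENNReal.ofReal ((1 / 2 : ℝ) ^ N)) atTop (𝓝 0) := by
    have := tendsto_pow_atTop_nhds_zero_of_lt_one (show (0 : ℝ) ≤ 1 / 2 by norm_num)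
      (by norm_num)
    simpa using ENNReal.tendsto_ofReal this
  have key := Measure.hausdorffMeasure_le_liminf_tsum (l := atTop) s (wellApproximable τ) _ hr
    (fun (N : ℕ) (i : Σ m : ℕ, (Fin (N + m) → ℕ) × ℕ) =>
      Icc (expand (List.ofFn i.2.1) (branch i.2.2 0))
        (expand (List.ofFn i.2.1) (branch i.2.2 0) +
          (cylLength (List.ofFn i.2.1) / (i.2.2 + 2)) ^ (1 + τ)))
    (Eventually.of_forall fun N i => by
      rw [hdiam]
      apply ENNReal.ofReal_le_ofReal
      obtain ⟨m, w, k⟩ := i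
      have hl := cylLength_pos (List.ofFn w)
      have hle := cylLength_le (List.ofFn w)
      rw [List.length_ofFn] at hle
      have hl1 : cylLength (List.ofFn w) ≤ 1 :=
        hle.trans (pow_le_one₀ (by norm_num) (by norm_num))
      have hk : (0 : ℝ) ≤ k := Nat.cast_nonneg k
      have h2 : cylLength (List.ofFn w) / (k + 2) ≤ cylLength (List.ofFn w) :=
        div_le_self hl.le (by linarith)
      calc (cylLength (List.ofFn w) / (k + 2)) ^ (1 + τ)
          ≤ (cylLength (List.ofFn w) / (k + 2)) ^ (1 : ℝ) :=
            Real.rpow_le_rpow_of_exponent_ge (by positivity) (h2.trans hl1) (by linarith)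
        _ ≤ cylLength (List.ofFn w) := by rwa [Real.rpow_one]
        _ ≤ (1 / 2) ^ (N + m) := hle
        _ ≤ (1 / 2) ^ N := pow_le_pow_of_le_one (by norm_num) (by norm_num) (by omega))
    (Eventually.of_forall fun N => wellApproximable_subset τ N)
  refine le_antisymm (key.trans ?_) bot_le
  -- Words of length N + m contribute p ^ (N + m), the last digit contributes Z, and summing over m
  -- gives the geometric factor.
  have hsum : ∀ N : ℕ, ∑' i : Σ m : ℕ, (Fin (N + m) → ℕ) × ℕ,
      ENNReal.ofReal ((cylLength (List.ofFn i.2.1) / (i.2.2 + 2)) ^ (1 + τ)) ^ s =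
      p ^ N * ((1 - p)⁻¹ * Z) := by
    intro N
    rw [ENNReal.tsum_sigma', ← ENNReal.tsum_geometric, ← ENNReal.tsum_mul_right,
      ← ENNReal.tsum_mul_left]
    refine tsum_congr fun m => ?_
    rw [ENNReal.tsum_prod', ← mul_assoc, ← pow_add, ← tsum_cylLength_rpow,
      ← ENNReal.tsum_mul_right]
    refine tsum_congr fun w => ?_
    rw [hZ, ← ENNReal.tsum_mul_left]
    refine tsum_congr fun k => ?_
    have hl := cylLength_pos (List.ofFn w)
    rw [ENNReal.ofReal_rpow_of_nonneg (by positivity) hs0.le, ← Real.rpow_mul (by positivity),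
      ← ENNReal.ofReal_mul (by positivity), ← Real.mul_rpow hl.le (by positivity), mul_one_div]
  simp only [hdiam, hsum]
  have hlim : Tendsto (fun N : ℕ => p ^ N * ((1 - p)⁻¹ * Z)) atTop (𝓝 0) := by
    have hfin : (1 - p)⁻¹ * Z ≠ ⊤ :=
      ENNReal.mul_ne_top (ENNReal.inv_ne_top.2 (tsub_pos_of_lt hp1).ne') hZtop
    simpa using ENNReal.Tendsto.mul_const (ENNReal.tendsto_pow_atTop_nhds_zero_of_lt_one hp1)
      (Or.inr hfin)
  exact hlim.liminf_eq.le

/-! ### Hausdorff dimension -/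

lemma dimH_wellApproximable_le {τ : ℝ} (hτ : 0 ≤ τ) :
    dimH (wellApproximable τ) ≤ ENNReal.ofReal (1 / (1 + τ)) := by
  refine le_of_forall_gt_imp_ge_of_dense fun c hc => ?_
  rcases eq_or_ne c ⊤ with rfl | hctop
  · exact le_top
  lift c to NNReal using hctop
  apply dimH_le_of_hausdorffMeasure_ne_top
  rw [hausdorffMeasure_wellApproximable_eq_zero hτ]
  · exact ENNReal.zero_ne_top
  · rw [← ENNReal.ofReal_coe_nnreal] at hc
    exact (ENNReal.ofReal_lt_ofReal_iff_of_nonneg (by positivity)).1 hc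

lemma le_dimH_wellApproximable {τ : ℝ} (hτ : 0 < τ) :
    ENNReal.ofReal (1 / (1 + τ)) ≤ dimH (wellApproximable τ) := by
  apply le_dimH_of_hausdorffMeasure_eq_top
  rw [Real.coe_toNNReal _ (by positivity)]
  exact hausdorffMeasure_wellApproximable hτ

/-- Since Q_n ≥ 1, a larger exponent only strengthens the condition. -/
lemma wellApproximable_subset_zero {τ : ℝ} (hτ : 0 ≤ τ) :
    wellApproximable τ ⊆ wellApproximable 0 := by
  intro x hx
  rw [mem_wellApproximable] at hx ⊢
  refine (hx.and_eventually (eventually_ge_atTop 1)).mono ?_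
  rintro n ⟨⟨hx01, h⟩, hn⟩
  refine ⟨hx01, h.trans_le ?_⟩
  obtain ⟨m, rfl⟩ : ∃ m, n = m + 1 := ⟨n - 1, by omega⟩
  obtain ⟨w, z, hz, rfl⟩ := exists_eq_expand m hx01
  obtain ⟨k, y, hy, rfl⟩ := exists_eq_branch hz
  have hQ := Q_expand (List.ofFn w) k hy
  rw [List.length_ofFn] at hQ
  rw [hQ]
  have hl := cylLength_pos (List.ofFn w)
  have hl1 : cylLength (List.ofFn w) ≤ 1 :=
    (cylLength_le _).trans (pow_le_one₀ (by norm_num) (by norm_num))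
  have hk : (0 : ℝ) ≤ k := Nat.cast_nonneg k
  apply one_div_le_one_div_of_le (by positivity)
  apply Real.rpow_le_rpow_of_exponent_le _ (by linarith)
  rw [le_div_iff₀ hl]
  linarith

/-- The layer argument needs s < 1, which excludes τ = 0. Here L(0) contains every L(τ), and 1 / (1
+ τ) tends to 1 as τ decreases to 0. -/
lemma one_le_dimH_wellApproximable_zero : 1 ≤ dimH (wellApproximable 0) := by
  have hlim : Tendsto (fun τ : ℝ => ENNReal.ofReal (1 / (1 + τ))) (𝓝[>] 0) (𝓝 1) := by
    have h : ContinuousAt (fun τ : ℝ => 1 / (1 + τ)) 0 := by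
      apply ContinuousAt.div continuousAt_const (by fun_prop) (by norm_num)
    have := ENNReal.tendsto_ofReal (h.tendsto.mono_left (nhdsWithin_le_nhds (s := Ioi 0)))
    simpa using this
  refine le_of_tendsto hlim ?_
  filter_upwards [self_mem_nhdsWithin] with τ hτ
  exact (le_dimH_wellApproximable hτ).trans
    (dimH_mono (wellApproximable_subset_zero (le_of_lt hτ)))

end Luroth

end

theorem theorem2 (τ : ℝ) (hτ : 0 ≤ τ) :
    dimH (Luroth.wellApproximable τ) = ENNReal.ofReal (1 / (1 + τ)) ∧
      (0 < τ →
        MeasureTheory.Measure.hausdorffMeasure (1 / (1 + τ)) (Luroth.wellApproximable τ) = ⊤) := by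
  refine ⟨le_antisymm (Luroth.dimH_wellApproximable_le hτ) ?_,
    Luroth.hausdorffMeasure_wellApproximable⟩
  rcases hτ.eq_or_lt with rfl | h
  · simpa using Luroth.one_le_dimH_wellApproximable_zero
  · exact Luroth.le_dimH_wellApproximable h
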